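/- Let $L$ be a first-order language (function symbols and predicate symbols with arities) with at least one predicate symbol of positive arity, and let terms be built from $L$ and countably many variables. Propositions are built from atomic propositions $P(t_1,\dots,t_n)$ and $\bot$ with $\Rightarrow,\wedge,\vee,\forall,\exists$, and are identified up to renaming of bound variables. A rewrite system $\mathcal R$ is a set of pairs of terms $l\to r$ such that $l$ is not a variable. Let $\to^1$ be the smallest relation on terms and on propositions that is compatible with their structure and satisfies $\theta l\to^1\theta r$ for each rule $l\to r$ of $\mathcal R$ and each substitution $\theta$, and let $\to^*$ be its reflexive-transitive closure. $\mathcal R$ is confluent if, for all terms $t,t_1,t_2$ with $t_1\leftarrow^* t\to^* t_2$, there is a term $s$ with $t_1\to^* s\leftarrow^* t_2$. Sequents $\Gamma\vdash\Delta$ are pairs of finite multisets of propositions. Asymmetric sequent calculus modulo $\mathcal R$ has the following rules (premises before the slash, conclusion after it): * Axiom: $/\;\Gamma,A_1\vdash A_2,\Delta$, if $A_1\to^* A\leftarrow^* A_2$ for some $A$. * Cut: $\Gamma\vdash C_1,\Delta$ and $\Gamma,C_2\vdash\Delta\;/\;\Gamma\vdash\Delta$, if $C_1\leftarrow^* C\to^*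 C_2$ for some $C$. * Contraction: $\Gamma,A_1,A_2\vdash\Delta\;/\;\Gamma,A\vdash\Delta$, and $\Gamma\vdash A_1,A_2,\Delta\;/\;\Gamma\vdash A,\Delta$, if $A_1\leftarrow^* A\to^* A_2$. * Weakening: $\Gamma\vdash\Delta\;/\;\Gamma,A\vdash\Delta$, and $\Gamma\vdash\Delta\;/\;\Gamma\vdash A,\Delta$. * If $C\to^* (A\Rightarrow B)$: $\Gamma\vdash A,\Delta$ and $\Gamma,B\vdash\Delta\;/\;\Gamma,C\vdash\Delta$; and $\Gamma,A\vdash B,\Delta\;/\;\Gamma\vdash C,\Delta$. * If $C\to^* (A\wedge B)$: $\Gamma,A,B\vdash\Delta\;/\;\Gamma,C\vdash\Delta$; and $\Gamma\vdash A,\Delta$ and $\Gamma\vdash B,\Delta\;/\;\Gamma\vdash C,\Delta$. * If $C\to^* (A\vee B)$: $\Gamma,A\vdash\Delta$ and $\Gamma,B\vdash\Delta\;/\;\Gamma,C\vdash\Delta$; and $\Gamma\vdash A,B,\Delta\;/\;\Gamma\vdash C,\Delta$. * If $A\to^*\bot$: $/\;\Gamma,A\vdash\Delta$. * If $B\to^*\forall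 x\,A$: $\Gamma,[t/x]A\vdash\Delta\;/\;\Gamma,B\vdash\Delta$ for any term $t$; and $\Gamma\vdash A,\Delta\;/\;\Gamma\vdash B,\Delta$ provided that $x$ is not free in $\Gamma,\Delta$. * If $B\to^*\exists x\,A$: $\Gamma,A\vdash\Delta\;/\;\Gamma,B\vdash\Delta$ provided that $x$ is not free in $\Gamma,\Delta$; and $\Gamma\vdash[t/x]A,\Delta\;/\;\Gamma\vdash B,\Delta$ for any term $t$. Then the cut rule is redundant, i.e. every sequent $\Gamma\vdash\Delta$ provable in this calculus has a proof that does not use the cut rule, if and only if $\mathcal R$ is confluent. -/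

import Mathlib

universe u v

namespace AsymmetricModulo

variable {L : FirstOrder.Language.{u, v}}

/-! ## First-order propositions

Terms are the terms `L.Term ℕ` of a first-order language with variables indexed by `ℕ`.
Propositions are represented up to renaming of bound variables, with de Bruijn indices: in the
body of a quantifier the variable `0` is the bound one, and the variable `k + 1` stands for the
variable `k` of the context of the quantifier. -/

/-- First-order propositions over the language `L`. -/
inductive Formula (L : FirstOrder.Language.{u, v}) : Type (max u v)
  | atom {n : ℕ} (P : L.Relations n) (ts : Fin n → L.Term ℕ) : Formula L
  | bot : Formula L
  | imp (A B : Formula L) : Formula L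
  | and (A B : Formula L) : Formula L
  | or (A B : Formula L) : Formula L
  | all (A : Formula L) : Formula L
  | ex (A : Formula L) : Formula L

/-- The substitution to be used in the body of a quantifier: it fixes the bound variable `0` and
acts as `σ` on the other variables, avoiding capture. -/
def up (σ : ℕ → L.Term ℕ) : ℕ → L.Term ℕ
  | 0 => FirstOrder.Language.Term.var 0
  | k + 1 => (σ k).relabel Nat.succ

/-- Simultaneous capture-avoiding substitution. -/
def Formula.subst : Formula L → (ℕ → L.Term ℕ) → Formula L
  | .atom P ts, σ => .atom P (fun i => (ts i).subst σ)
  | .bot, _ => .bot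
  | .imp A B, σ => .imp (A.subst σ) (B.subst σ)
  | .and A B, σ => .and (A.subst σ) (B.subst σ)
  | .or A B, σ => .or (A.subst σ) (B.subst σ)
  | .all A, σ => .all (A.subst (up σ))
  | .ex A, σ => .ex (A.subst (up σ))

/-- If `A` is the body of a quantifier binding `x`, then `A.inst t` is `[t/x]A`. -/
def Formula.inst (A : Formula L) (t : L.Term ℕ) : Formula L :=
  A.subst (fun k => match k with
    | 0 => t
    | j + 1 => FirstOrder.Language.Term.var j)

/-- The proposition `A`, moved to a context with a new variable `0`, which is not free in it. -/
def Formula.shift (A : Formula L) : Formula L :=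
  A.subst (fun k => FirstOrder.Language.Term.var (k + 1))

/-! ## Rewriting -/

/-- A rewrite system on the terms of `L`: a set of rules `l → r` whose left-hand side `l` is not
a variable. -/
structure RewriteSystem (L : FirstOrder.Language.{u, v}) where
  rules : Set (L.Term ℕ × L.Term ℕ)
  lhs_not_var : ∀ p ∈ rules, ∀ x : ℕ, p.1 ≠ FirstOrder.Language.Term.var x

/-- One-step rewriting of terms. -/
inductive TermStep (R : RewriteSystem L) : L.Term ℕ → L.Term ℕ → Prop
  | rule {l r : L.Term ℕ} (h : (l, r) ∈ R.rules) (θ : ℕ → L.Term ℕ) :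
      TermStep R (l.subst θ) (r.subst θ)
  | func {n : ℕ} (f : L.Functions n) (ts : Fin n → L.Term ℕ) (i : Fin n) {t : L.Term ℕ}
      (h : TermStep R (ts i) t) :
      TermStep R (FirstOrder.Language.Term.func f ts) (FirstOrder.Language.Term.func f (Function.update ts i t))

/-- One-step rewriting of propositions: one step on a term that occurs in the proposition. -/
inductive Step (R : RewriteSystem L) : Formula L → Formula L → Prop
  | atom {n : ℕ} (P : L.Relations n) (ts : Fin n → L.Term ℕ) (i : Fin n) {t : L.Term ℕ}
      (h : TermStep R (ts i) t) :
      Step R (.atom P ts) (.atom P (Function.update ts i t))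
  | imp_left {A A' : Formula L} (B : Formula L) (h : Step R A A') :
      Step R (.imp A B) (.imp A' B)
  | imp_right (A : Formula L) {B B' : Formula L} (h : Step R B B') :
      Step R (.imp A B) (.imp A B')
  | and_left {A A' : Formula L} (B : Formula L) (h : Step R A A') :
      Step R (.and A B) (.and A' B)
  | and_right (A : Formula L) {B B' : Formula L} (h : Step R B B') :
      Step R (.and A B) (.and A B')
  | or_left {A A' : Formula L} (B : Formula L) (h : Step R A A') :
      Step R (.or A B) (.or A' B)
  | or_right (A : Formula L) {B B' : Formula L} (h : Step R B B') :
      Step R (.or A B) (.or A B')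
  | all {A A' : Formula L} (h : Step R A A') : Step R (.all A) (.all A')
  | ex {A A' : Formula L} (h : Step R A A') : Step R (.ex A) (.ex A')

/-- Rewriting of terms in any number of steps. -/
def TermRed (R : RewriteSystem L) : L.Term ℕ → L.Term ℕ → Prop :=
  Relation.ReflTransGen (TermStep R)

/-- Rewriting of propositions in any number of steps. -/
def Red (R : RewriteSystem L) : Formula L → Formula L → Prop :=
  Relation.ReflTransGen (Step R)

/-- The rewrite system is confluent: any two reducts of a term have a common reduct. -/
def RewriteSystem.Confluent (R : RewriteSystem L) : Prop :=
  ∀ t t₁ t₂ : L.Term ℕ, TermRed R t t₁ → TermRed R t t₂ →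
    ∃ s : L.Term ℕ, TermRed R t₁ s ∧ TermRed R t₂ s

/-! ## Asymmetric sequent calculus modulo -/

/-- `Provable R cut Γ Δ`: the sequent `Γ ⊢ Δ` has a proof in asymmetric sequent calculus modulo
`R`. The cut rule may be used in the proof if `cut = true`; the proof is cut free if
`cut = false`. All other rules do not depend on `cut`.

In `all_right` and `ex_left` the eigenvariable is the variable `0`: it is not free in the
shifted side propositions. -/
inductive Provable (R : RewriteSystem L) (cut : Bool) :
    Multiset (Formula L) → Multiset (Formula L) → Prop
  | ax {Γ Δ : Multiset (Formula L)} {A A₁ A₂ : Formula L}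
      (h₁ : Red R A₁ A) (h₂ : Red R A₂ A) :
      Provable R cut (A₁ ::ₘ Γ) (A₂ ::ₘ Δ)
  | cut_rule {Γ Δ : Multiset (Formula L)} {C C₁ C₂ : Formula L} (hcut : cut = true)
      (h₁ : Red R C C₁) (h₂ : Red R C C₂)
      (p₁ : Provable R cut Γ (C₁ ::ₘ Δ)) (p₂ : Provable R cut (C₂ ::ₘ Γ) Δ) :
      Provable R cut Γ Δ
  | contr_left {Γ Δ : Multiset (Formula L)} {A A₁ A₂ : Formula L}
      (h₁ : Red R A A₁) (h₂ : Red R A A₂)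
      (p : Provable R cut (A₁ ::ₘ A₂ ::ₘ Γ) Δ) :
      Provable R cut (A ::ₘ Γ) Δ
  | contr_right {Γ Δ : Multiset (Formula L)} {A A₁ A₂ : Formula L}
      (h₁ : Red R A A₁) (h₂ : Red R A A₂)
      (p : Provable R cut Γ (A₁ ::ₘ A₂ ::ₘ Δ)) :
      Provable R cut Γ (A ::ₘ Δ)
  | weak_left {Γ Δ : Multiset (Formula L)} {A : Formula L} (p : Provable R cut Γ Δ) :
      Provable R cut (A ::ₘ Γ) Δ
  | weak_right {Γ Δ : Multiset (Formula L)} {A : Formula L} (p : Provable R cut Γ Δ) :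
      Provable R cut Γ (A ::ₘ Δ)
  | imp_left {Γ Δ : Multiset (Formula L)} {A B C : Formula L} (h : Red R C (.imp A B))
      (p₁ : Provable R cut Γ (A ::ₘ Δ)) (p₂ : Provable R cut (B ::ₘ Γ) Δ) :
      Provable R cut (C ::ₘ Γ) Δ
  | imp_right {Γ Δ : Multiset (Formula L)} {A B C : Formula L} (h : Red R C (.imp A B))
      (p : Provable R cut (A ::ₘ Γ) (B ::ₘ Δ)) :
      Provable R cut Γ (C ::ₘ Δ)
  | and_left {Γ Δ : Multiset (Formula L)} {A B C : Formula L} (h : Red R C (.and A B))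
      (p : Provable R cut (A ::ₘ B ::ₘ Γ) Δ) :
      Provable R cut (C ::ₘ Γ) Δ
  | and_right {Γ Δ : Multiset (Formula L)} {A B C : Formula L} (h : Red R C (.and A B))
      (p₁ : Provable R cut Γ (A ::ₘ Δ)) (p₂ : Provable R cut Γ (B ::ₘ Δ)) :
      Provable R cut Γ (C ::ₘ Δ)
  | or_left {Γ Δ : Multiset (Formula L)} {A B C : Formula L} (h : Red R C (.or A B))
      (p₁ : Provable R cut (A ::ₘ Γ) Δ) (p₂ : Provable R cut (B ::ₘ Γ) Δ) :
      Provable R cut (C ::ₘ Γ) Δ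
  | or_right {Γ Δ : Multiset (Formula L)} {A B C : Formula L} (h : Red R C (.or A B))
      (p : Provable R cut Γ (A ::ₘ B ::ₘ Δ)) :
      Provable R cut Γ (C ::ₘ Δ)
  | bot_left {Γ Δ : Multiset (Formula L)} {A : Formula L} (h : Red R A .bot) :
      Provable R cut (A ::ₘ Γ) Δ
  | all_left {Γ Δ : Multiset (Formula L)} {A B : Formula L} (t : L.Term ℕ)
      (h : Red R B (.all A)) (p : Provable R cut (A.inst t ::ₘ Γ) Δ) :
      Provable R cut (B ::ₘ Γ) Δ
  | all_right {Γ Δ : Multiset (Formula L)} {A B : Formula L} (h : Red R B (.all A))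
      (p : Provable R cut (Γ.map Formula.shift) (A ::ₘ Δ.map Formula.shift)) :
      Provable R cut Γ (B ::ₘ Δ)
  | ex_left {Γ Δ : Multiset (Formula L)} {A B : Formula L} (h : Red R B (.ex A))
      (p : Provable R cut (A ::ₘ Γ.map Formula.shift) (Δ.map Formula.shift)) :
      Provable R cut (B ::ₘ Γ) Δ
  | ex_right {Γ Δ : Multiset (Formula L)} {A B : Formula L} (t : L.Term ℕ)
      (h : Red R B (.ex A)) (p : Provable R cut Γ (A.inst t ::ₘ Δ)) :
      Provable R cut Γ (B ::ₘ Δ)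

/-- The cut rule is redundant: every provable sequent has a cut-free proof. -/
def CutRedundant (R : RewriteSystem L) : Prop :=
  ∀ Γ Δ : Multiset (Formula L), Provable R true Γ Δ → Provable R false Γ Δ

end AsymmetricModulo

/-! Cut elimination gives confluence: if `t` reduces to `t₁` and `t₂`, one cut on `P(t,…,t)` proves
`P(t₁,…,t₁) ⊢ P(t₂,…,t₂)`. A cut-free proof of this sequent contains only reducts of the left atom
on the left and of the right atom on the right, so no logical rule applies, and an axiom at a leaf
exhibits a common reduct (`Provable.exists_common_reduct`).

Conversely, confluence gives cut elimination semantically, without any termination argument.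
Sequents form a commutative monoid under componentwise union; two of them are orthogonal when their
sum is cut-free provable. A proposition is interpreted by a biorthogonally closed set of sequents
(`Forces.of_refutes`), and `Refutes` is the orthogonal of that set. An atom is interpreted by the
orthogonal of the sequents `⊢ P(us)` with `us` joinable to its arguments; confluence makes
joinability transitive, so interpretations are invariant under rewriting (`Forces.red_iff`). All
rules, cut included, are sound for this model (`Provable.sound`). Okada's lemma
`forces_left_and_refutes_right` says that `A ⊢` forces `A` and `⊢ A` refutes it. Hence `Γ ⊢ Δ`,
taken as a world, forces all of `Γ` and refutes all of `Δ`, and soundness at this world is cut-free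
provability. -/

namespace AsymmetricModulo

open FirstOrder.Language

variable {L : FirstOrder.Language.{u, v}}

/-! ## Substitutions -/

theorem term_subst_subst {α β γ : Type*} (t : L.Term α) (σ : α → L.Term β) (τ : β → L.Term γ) :
    (t.subst σ).subst τ = t.subst (fun k => (σ k).subst τ) := by
  induction t with
  | var x => rfl
  | func f ts ih => simp only [Term.subst, ih]

theorem term_subst_var {α : Type*} (t : L.Term α) : t.subst Term.var = t := by
  induction t with
  | var x => rfl
  | func f ts ih => simp only [Term.subst, ih]

theorem term_relabel_eq_subst {α β : Type*} (t : L.Term α) (g : α → β) :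
    t.relabel g = t.subst (fun k => Term.var (g k)) := by
  induction t with
  | var x => rfl
  | func f ts ih => simp only [Term.subst, Term.relabel, ih]

/-- The substitution that sends the variable `0` to `t` and acts as `σ` on the shifted
variables. -/
def scons (t : L.Term ℕ) (σ : ℕ → L.Term ℕ) : ℕ → L.Term ℕ
  | 0 => t
  | k + 1 => σ k

theorem up_eq_scons (σ : ℕ → L.Term ℕ) :
    up σ = scons (Term.var 0) (fun k => (σ k).subst (fun j => Term.var (j + 1))) := by
  funext k
  cases k with
  | zero => rfl
  | succ k => exact term_relabel_eq_subst _ _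

theorem up_subst_scons (σ τ : ℕ → L.Term ℕ) (t : L.Term ℕ) :
    (fun k => (up σ k).subst (scons t τ)) = scons t (fun k => (σ k).subst τ) := by
  funext k
  cases k with
  | zero => rfl
  | succ k => simp only [up_eq_scons, scons, term_subst_subst, Term.subst]

theorem up_subst_up (σ τ : ℕ → L.Term ℕ) :
    (fun k => (up σ k).subst (up τ)) = up (fun k => (σ k).subst τ) := by
  rw [up_eq_scons τ, up_subst_scons, up_eq_scons]
  simp only [term_subst_subst]

theorem up_var : up (Term.var : ℕ → L.Term ℕ) = Term.var := by
  funext k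
  cases k <;> rfl

namespace Formula

theorem subst_subst (A : Formula L) (σ τ : ℕ → L.Term ℕ) :
    (A.subst σ).subst τ = A.subst (fun k => (σ k).subst τ) := by
  induction A generalizing σ τ with
  | atom P ts => simp only [subst, term_subst_subst]
  | bot => rfl
  | imp A B ihA ihB => simp only [subst, ihA, ihB]
  | and A B ihA ihB => simp only [subst, ihA, ihB]
  | or A B ihA ihB => simp only [subst, ihA, ihB]
  | all A ih => simp only [subst, ih, up_subst_up]
  | ex A ih => simp only [subst, ih, up_subst_up]

theorem subst_var (A : Formula L) : A.subst Term.var = A := by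
  induction A with
  | atom P ts => simp only [subst, term_subst_var]
  | bot => rfl
  | imp A B ihA ihB => simp only [subst, ihA, ihB]
  | and A B ihA ihB => simp only [subst, ihA, ihB]
  | or A B ihA ihB => simp only [subst, ihA, ihB]
  | all A ih => simp only [subst, up_var, ih]
  | ex A ih => simp only [subst, up_var, ih]

theorem inst_eq_subst (A : Formula L) (t : L.Term ℕ) : A.inst t = A.subst (scons t Term.var) := by
  unfold inst
  congr 1

theorem inst_subst (A : Formula L) (t : L.Term ℕ) (σ : ℕ → L.Term ℕ) :
    (A.inst t).subst σ = (A.subst (up σ)).inst (t.subst σ) := by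
  rw [inst_eq_subst, inst_eq_subst, subst_subst, subst_subst, up_subst_scons]
  congr 1
  funext k
  cases k with
  | zero => rfl
  | succ k => exact (term_subst_var _).symm

theorem subst_up_inst (A : Formula L) (t : L.Term ℕ) (σ : ℕ → L.Term ℕ) :
    (A.subst (up σ)).inst t = A.subst (scons t σ) := by
  rw [inst_eq_subst, subst_subst, up_subst_scons]
  simp only [term_subst_var]

theorem shift_subst (A : Formula L) (σ : ℕ → L.Term ℕ) :
    A.shift.subst (up σ) = (A.subst σ).shift := by
  unfold shift
  rw [subst_subst, subst_subst]
  congr 1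
  funext k
  exact term_relabel_eq_subst _ _

end Formula

/-! ### Dependence on finitely many variables -/

theorem term_exists_bound (t : L.Term ℕ) :
    ∃ N, ∀ σ τ : ℕ → L.Term ℕ, (∀ k < N, σ k = τ k) → t.subst σ = t.subst τ := by
  induction t with
  | var x => exact ⟨x + 1, fun σ τ h => h x x.lt_succ_self⟩
  | func f ts ih =>
    choose N hN using ih
    refine ⟨Finset.univ.sup N, fun σ τ h => ?_⟩
    simp only [Term.subst]
    congr 1
    funext i
    exact hN i σ τ fun k hk => h k (hk.trans_le (Finset.le_sup (Finset.mem_univ i)))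

/-- Agreement even extends to `N + 1`; this weaker form lets a quantifier inherit the bound of its
body. -/
theorem up_congr {N : ℕ} {σ τ : ℕ → L.Term ℕ} (h : ∀ k < N, σ k = τ k) :
    ∀ k < N, up σ k = up τ k := by
  intro k hk
  cases k with
  | zero => rfl
  | succ k => simp only [up, h k (Nat.lt_of_succ_lt hk)]

/-- The result of a substitution depends on finitely many variables only. -/
theorem Formula.exists_bound (A : Formula L) :
    ∃ N, ∀ σ τ : ℕ → L.Term ℕ, (∀ k < N, σ k = τ k) → A.subst σ = A.subst τ := by
  have two : ∀ {A B : Formula L},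
      (∃ N, ∀ σ τ : ℕ → L.Term ℕ, (∀ k < N, σ k = τ k) → A.subst σ = A.subst τ) →
      (∃ N, ∀ σ τ : ℕ → L.Term ℕ, (∀ k < N, σ k = τ k) → B.subst σ = B.subst τ) →
      ∃ N, ∀ σ τ : ℕ → L.Term ℕ, (∀ k < N, σ k = τ k) →
        A.subst σ = A.subst τ ∧ B.subst σ = B.subst τ := by
    rintro A B ⟨M, hM⟩ ⟨N, hN⟩
    exact ⟨max M N, fun σ τ h => ⟨hM σ τ fun k hk => h k (lt_max_of_lt_left hk),
      hN σ τ fun k hk => h k (lt_max_of_lt_right hk)⟩⟩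
  induction A with
  | atom P ts =>
    choose N hN using fun i => term_exists_bound (ts i)
    refine ⟨Finset.univ.sup N, fun σ τ h => ?_⟩
    simp only [subst]
    congr 1
    funext i
    exact hN i σ τ fun k hk => h k (hk.trans_le (Finset.le_sup (Finset.mem_univ i)))
  | bot => exact ⟨0, fun _ _ _ => rfl⟩
  | imp A B ihA ihB =>
    obtain ⟨N, hN⟩ := two ihA ihB
    exact ⟨N, fun σ τ h => by simp only [subst, hN σ τ h]⟩
  | and A B ihA ihB =>
    obtain ⟨N, hN⟩ := two ihA ihB
    exact ⟨N, fun σ τ h => by simp only [subst, hN σ τ h]⟩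
  | or A B ihA ihB =>
    obtain ⟨N, hN⟩ := two ihA ihB
    exact ⟨N, fun σ τ h => by simp only [subst, hN σ τ h]⟩
  | all A ih =>
    obtain ⟨N, hN⟩ := ih
    exact ⟨N, fun σ τ h => by simp only [subst, hN _ _ (up_congr h)]⟩
  | ex A ih =>
    obtain ⟨N, hN⟩ := ih
    exact ⟨N, fun σ τ h => by simp only [subst, hN _ _ (up_congr h)]⟩

theorem exists_bound_multiset (Γ : Multiset (Formula L)) :
    ∃ N, ∀ A ∈ Γ, ∀ σ τ : ℕ → L.Term ℕ, (∀ k < N, σ k = τ k) → A.subst σ = A.subst τ := by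
  choose N hN using fun A : Formula L => A.exists_bound
  induction Γ using Multiset.induction with
  | empty => exact ⟨0, fun A hA => absurd hA (Multiset.notMem_zero A)⟩
  | cons B Γ ih =>
    obtain ⟨M, hM⟩ := ih
    refine ⟨max (N B) M, fun A hA σ τ h => ?_⟩
    rcases Multiset.mem_cons.1 hA with rfl | hA
    · exact hN A σ τ fun k hk => h k (lt_max_of_lt_left hk)
    · exact hM A hA σ τ fun k hk => h k (lt_max_of_lt_right hk)

/-! ## Rewriting -/

variable {R : RewriteSystem L}

theorem update_subst {n : ℕ} (ts : Fin n → L.Term ℕ) (i : Fin n) (t : L.Term ℕ)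
    (σ : ℕ → L.Term ℕ) :
    (fun j => (Function.update ts i t j).subst σ) =
      Function.update (fun j => (ts j).subst σ) i (t.subst σ) := by
  funext j
  by_cases h : j = i
  · subst h
    simp
  · simp [h]

theorem TermStep.subst {s t : L.Term ℕ} (h : TermStep R s t) (σ : ℕ → L.Term ℕ) :
    TermStep R (s.subst σ) (t.subst σ) := by
  induction h with
  | rule h θ =>
    rw [term_subst_subst, term_subst_subst]
    exact .rule h _
  | func f ts i _ ih =>
    simp only [Term.subst, update_subst]
    exact .func f _ i ih

theorem TermRed.subst {s t : L.Term ℕ} (h : TermRed R s t) (σ : ℕ → L.Term ℕ) :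
    TermRed R (s.subst σ) (t.subst σ) :=
  Relation.ReflTransGen.lift (fun s => Term.subst s σ) (fun _ _ h => TermStep.subst h σ) _ _ h

theorem Step.subst {A B : Formula L} (h : Step R A B) (σ : ℕ → L.Term ℕ) :
    Step R (A.subst σ) (B.subst σ) := by
  induction h generalizing σ with
  | atom P ts i h =>
    simp only [Formula.subst, update_subst]
    exact .atom P _ i (h.subst σ)
  | imp_left B _ ih => exact .imp_left _ (ih σ)
  | imp_right A _ ih => exact .imp_right _ (ih σ)
  | and_left B _ ih => exact .and_left _ (ih σ)
  | and_right A _ ih => exact .and_right _ (ih σ)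
  | or_left B _ ih => exact .or_left _ (ih σ)
  | or_right A _ ih => exact .or_right _ (ih σ)
  | all _ ih => exact .all (ih _)
  | ex _ ih => exact .ex (ih _)

theorem Red.subst {A B : Formula L} (h : Red R A B) (σ : ℕ → L.Term ℕ) :
    Red R (A.subst σ) (B.subst σ) :=
  Relation.ReflTransGen.lift (fun A => Formula.subst A σ) (fun _ _ h => Step.subst h σ) _ _ h

theorem Red.refl (A : Formula L) : Red R A A := Relation.ReflTransGen.refl

theorem Red.atom_update {n : ℕ} (P : L.Relations n) (ts : Fin n → L.Term ℕ) (i : Fin n)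
    {t : L.Term ℕ} (h : TermRed R (ts i) t) :
    Red R (.atom P ts) (.atom P (Function.update ts i t)) := by
  induction h with
  | refl =>
    rw [Function.update_eq_self]
    exact Red.refl _
  | @tail a b _ hs ih =>
    refine ih.tail ?_
    have := Step.atom (R := R) P (Function.update ts i a) i (t := b)
      (by rwa [Function.update_self])
    rwa [Function.update_idem] at this

theorem Red.atom {n : ℕ} (P : L.Relations n) {ts us : Fin n → L.Term ℕ}
    (h : ∀ i, TermRed R (ts i) (us i)) : Red R (.atom P ts) (.atom P us) := by
  -- The arguments are rewritten one at a time; `s` collects those already done.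
  have key : ∀ s : Finset (Fin n), Red R (.atom P ts) (.atom P (s.piecewise us ts)) := by
    intro s
    induction s using Finset.induction_on with
    | empty =>
      rw [Finset.piecewise_empty]
      exact Red.refl _
    | insert i s hi ih =>
      rw [Finset.piecewise_insert]
      refine Relation.ReflTransGen.trans ih (Red.atom_update P _ i ?_)
      rw [Finset.piecewise_eq_of_notMem _ _ _ hi]
      exact h i
  simpa using key Finset.univ

theorem Red.of_atom {n : ℕ} {P : L.Relations n} {ts : Fin n → L.Term ℕ} {B : Formula L}
    (h : Red R (.atom P ts) B) : ∃ us, B = .atom P us ∧ ∀ i, TermRed R (ts i) (us i) := by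
  induction h with
  | refl => exact ⟨ts, rfl, fun _ => .refl⟩
  | tail _ hs ih =>
    obtain ⟨us, rfl, hus⟩ := ih
    cases hs with
    | atom _ _ i h =>
      refine ⟨_, rfl, fun j => ?_⟩
      by_cases hj : j = i
      · subst hj
        rw [Function.update_self]
        exact (hus j).tail h
      · rw [Function.update_of_ne hj]
        exact hus j

/-! ## Cut elimination implies confluence -/

/-- The invariant on both sides survives contraction and weakening, read from conclusion to premise,
so the induction can only end at an axiom. -/
theorem Provable.exists_common_reduct {n : ℕ} {P : L.Relations n} {ts us : Fin n → L.Term ℕ}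
    {Γ Δ : Multiset (Formula L)} (p : Provable R false Γ Δ)
    (hΓ : ∀ A ∈ Γ, Red R (.atom P ts) A) (hΔ : ∀ A ∈ Δ, Red R (.atom P us) A) :
    ∃ A, Red R (.atom P ts) A ∧ Red R (.atom P us) A := by
  -- A logical rule would require a reduct of an atom to be compound or `⊥`.
  have absurd_left : ∀ {Γ : Multiset (Formula L)} {C D : Formula L},
      (∀ A ∈ C ::ₘ Γ, Red R (.atom P ts) A) → Red R C D → ∃ vs, D = .atom P vs :=
    fun hΓ h => (Red.of_atom ((hΓ _ (Multiset.mem_cons_self _ _)).trans h)).imp fun _ h => h.1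
  have absurd_right : ∀ {Γ : Multiset (Formula L)} {C D : Formula L},
      (∀ A ∈ C ::ₘ Γ, Red R (.atom P us) A) → Red R C D → ∃ vs, D = .atom P vs :=
    fun hΓ h => (Red.of_atom ((hΓ _ (Multiset.mem_cons_self _ _)).trans h)).imp fun _ h => h.1
  induction p with
  | ax h₁ h₂ =>
    exact ⟨_, (hΓ _ (Multiset.mem_cons_self _ _)).trans h₁,
      (hΔ _ (Multiset.mem_cons_self _ _)).trans h₂⟩
  | cut_rule hcut => exact absurd hcut Bool.false_ne_true
  | contr_left h₁ h₂ _ ih =>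
    simp only [Multiset.forall_mem_cons] at hΓ ih
    exact ih ⟨hΓ.1.trans h₁, hΓ.1.trans h₂, hΓ.2⟩ hΔ
  | contr_right h₁ h₂ _ ih =>
    simp only [Multiset.forall_mem_cons] at hΔ ih
    exact ih hΓ ⟨hΔ.1.trans h₁, hΔ.1.trans h₂, hΔ.2⟩
  | weak_left _ ih => exact ih (fun A hA => hΓ A (Multiset.mem_cons_of_mem hA)) hΔ
  | weak_right _ ih => exact ih hΓ (fun A hA => hΔ A (Multiset.mem_cons_of_mem hA))
  | imp_left h => obtain ⟨_, h⟩ := absurd_left hΓ h; cases h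
  | imp_right h => obtain ⟨_, h⟩ := absurd_right hΔ h; cases h
  | and_left h => obtain ⟨_, h⟩ := absurd_left hΓ h; cases h
  | and_right h => obtain ⟨_, h⟩ := absurd_right hΔ h; cases h
  | or_left h => obtain ⟨_, h⟩ := absurd_left hΓ h; cases h
  | or_right h => obtain ⟨_, h⟩ := absurd_right hΔ h; cases h
  | bot_left h => obtain ⟨_, h⟩ := absurd_left hΓ h; cases h
  | all_left _ h => obtain ⟨_, h⟩ := absurd_left hΓ h; cases h
  | all_right h => obtain ⟨_, h⟩ := absurd_right hΔ h; cases h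
  | ex_left h => obtain ⟨_, h⟩ := absurd_left hΓ h; cases h
  | ex_right _ h => obtain ⟨_, h⟩ := absurd_right hΔ h; cases h

theorem CutRedundant.confluent {n : ℕ} (P : L.Relations (n + 1)) (h : CutRedundant R) :
    R.Confluent := by
  intro t t₁ t₂ h₁ h₂
  have p : Provable R true {.atom P fun _ => t₁} {.atom P fun _ => t₂} :=
    .cut_rule rfl (Red.atom P fun _ => h₁) (Red.atom P fun _ => h₂)
      (.ax (Red.refl _) (Red.refl _)) (.ax (Red.refl _) (Red.refl _))
  obtain ⟨A, hA₁, hA₂⟩ := (h _ _ p).exists_common_reduct (P := P) (ts := fun _ => t₁)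
    (us := fun _ => t₂) (by simp [Red.refl]) (by simp [Red.refl])
  obtain ⟨us, rfl, hus⟩ := hA₁.of_atom
  obtain ⟨vs, h, hvs⟩ := hA₂.of_atom
  cases h
  exact ⟨us 0, hus 0, hvs 0⟩

/-! ## Cut-free provability -/

theorem Provable.subst {c : Bool} {Γ Δ : Multiset (Formula L)} (p : Provable R c Γ Δ)
    (σ : ℕ → L.Term ℕ) :
    Provable R c (Γ.map fun A => A.subst σ) (Δ.map fun A => A.subst σ) := by
  induction p generalizing σ with
  | ax h₁ h₂ =>
    simp only [Multiset.map_cons]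
    exact .ax (h₁.subst σ) (h₂.subst σ)
  | cut_rule hcut h₁ h₂ _ _ ih₁ ih₂ =>
    simp only [Multiset.map_cons] at ih₁ ih₂
    exact .cut_rule hcut (h₁.subst σ) (h₂.subst σ) (ih₁ σ) (ih₂ σ)
  | contr_left h₁ h₂ _ ih =>
    simp only [Multiset.map_cons] at ih ⊢
    exact .contr_left (h₁.subst σ) (h₂.subst σ) (ih σ)
  | contr_right h₁ h₂ _ ih =>
    simp only [Multiset.map_cons] at ih ⊢
    exact .contr_right (h₁.subst σ) (h₂.subst σ) (ih σ)
  | weak_left _ ih =>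
    simp only [Multiset.map_cons]
    exact .weak_left (ih σ)
  | weak_right _ ih =>
    simp only [Multiset.map_cons]
    exact .weak_right (ih σ)
  | imp_left h _ _ ih₁ ih₂ =>
    simp only [Multiset.map_cons] at ih₁ ih₂ ⊢
    exact .imp_left (h.subst σ) (ih₁ σ) (ih₂ σ)
  | imp_right h _ ih =>
    simp only [Multiset.map_cons] at ih ⊢
    exact .imp_right (h.subst σ) (ih σ)
  | and_left h _ ih =>
    simp only [Multiset.map_cons] at ih ⊢
    exact .and_left (h.subst σ) (ih σ)
  | and_right h _ _ ih₁ ih₂ =>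
    simp only [Multiset.map_cons] at ih₁ ih₂ ⊢
    exact .and_right (h.subst σ) (ih₁ σ) (ih₂ σ)
  | or_left h _ _ ih₁ ih₂ =>
    simp only [Multiset.map_cons] at ih₁ ih₂ ⊢
    exact .or_left (h.subst σ) (ih₁ σ) (ih₂ σ)
  | or_right h _ ih =>
    simp only [Multiset.map_cons] at ih ⊢
    exact .or_right (h.subst σ) (ih σ)
  | bot_left h =>
    simp only [Multiset.map_cons]
    exact .bot_left (h.subst σ)
  | all_left t h _ ih =>
    simp only [Multiset.map_cons, Formula.inst_subst] at ih ⊢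
    exact .all_left _ (h.subst σ) (ih σ)
  | all_right h _ ih =>
    -- The premise lives under one more variable, and `up σ` fixes the eigenvariable.
    have := ih (up σ)
    simp only [Multiset.map_cons, Multiset.map_map, Function.comp_def, Formula.shift_subst]
      at this ⊢
    refine .all_right (h.subst σ) ?_
    simpa only [Multiset.map_map, Function.comp_def] using this
  | ex_left h _ ih =>
    have := ih (up σ)
    simp only [Multiset.map_cons, Multiset.map_map, Function.comp_def, Formula.shift_subst]
      at this ⊢
    refine .ex_left (h.subst σ) ?_
    simpa only [Multiset.map_map, Function.comp_def] using this
  | ex_right t h _ ih =>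
    simp only [Multiset.map_cons, Formula.inst_subst] at ih ⊢
    exact .ex_right _ (h.subst σ) (ih σ)

theorem map_subst_eq_map_shift {N : ℕ} {Γ : Multiset (Formula L)}
    (hN : ∀ A ∈ Γ, ∀ σ τ : ℕ → L.Term ℕ, (∀ k < N, σ k = τ k) → A.subst σ = A.subst τ)
    {σ : ℕ → L.Term ℕ} (h : ∀ k < N, σ k = Term.var (k + 1)) :
    (Γ.map fun A => A.subst σ) = Γ.map Formula.shift :=
  Multiset.map_congr rfl fun A hA => hN A hA _ _ h

/-- A fresh variable may be used as the eigenvariable of a quantifier rule: the variable `N` can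
be renamed to the variable `0` of the extended context. -/
theorem exists_fresh (Γ Δ : Multiset (Formula L)) (A : Formula L) :
    ∃ (N : ℕ) (σ : ℕ → L.Term ℕ), (Γ.map fun B => B.subst σ) = Γ.map Formula.shift ∧
      (Δ.map fun B => B.subst σ) = Δ.map Formula.shift ∧
      (A.inst (Term.var N)).subst σ = A := by
  obtain ⟨N, hN⟩ := exists_bound_multiset (A ::ₘ (Γ + Δ))
  have hσ : ∀ k < N, (fun k => if k = N then Term.var 0 else Term.var (k + 1) :
      ℕ → L.Term ℕ) k = Term.var (k + 1) := fun k hk => if_neg hk.ne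
  refine ⟨N, fun k => if k = N then Term.var 0 else Term.var (k + 1), ?_, ?_, ?_⟩
  · exact map_subst_eq_map_shift (fun B hB => hN B (by simp [hB])) hσ
  · exact map_subst_eq_map_shift (fun B hB => hN B (by simp [hB])) hσ
  · rw [Formula.inst_eq_subst, Formula.subst_subst]
    conv_rhs => rw [← A.subst_var]
    -- In the body `A`, index `k + 1` denotes the context variable `k`, so `k + 1 < N` keeps `k`
    -- away from the renamed variable `N`.
    refine hN A (Multiset.mem_cons_self _ _) _ _ fun k hk => ?_
    cases k with
    | zero => simp [scons, Term.subst]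
    | succ k => simp [scons, Term.subst, (Nat.lt_of_succ_lt hk).ne]

theorem Provable.weaken {c : Bool} {Γ Δ : Multiset (Formula L)} (p : Provable R c Γ Δ)
    (Γ' Δ' : Multiset (Formula L)) : Provable R c (Γ + Γ') (Δ + Δ') := by
  induction Γ' using Multiset.induction with
  | empty =>
    induction Δ' using Multiset.induction with
    | empty => simpa using p
    | cons A Δ' ih =>
      rw [Multiset.add_cons]
      exact ih.weak_right
  | cons A Γ' ih =>
    rw [Multiset.add_cons]
    exact ih.weak_left

theorem Provable.contract {c : Bool} {Γ Γ' Δ Δ' : Multiset (Formula L)}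
    (p : Provable R c (Γ + Γ + Γ') (Δ + Δ + Δ')) : Provable R c (Γ + Γ') (Δ + Δ') := by
  induction Γ using Multiset.induction generalizing Γ' with
  | empty =>
    induction Δ using Multiset.induction generalizing Δ' with
    | empty => simpa using p
    | cons A Δ ih =>
      rw [Multiset.cons_add, ← Multiset.add_cons]
      refine ih ?_
      rw [Multiset.add_cons]
      refine .contr_right (Red.refl _) (Red.refl _) ?_
      simpa only [Multiset.cons_add, Multiset.add_cons] using p
  | cons A Γ ih =>
    rw [Multiset.cons_add, ← Multiset.add_cons]
    refine ih ?_
    rw [Multiset.add_cons]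
    refine .contr_left (Red.refl _) (Red.refl _) ?_
    simpa only [Multiset.cons_add, Multiset.add_cons] using p

/-- Sequents, as elements of a commutative monoid. -/
abbrev Seq (L : FirstOrder.Language.{u, v}) := Multiset (Formula L) × Multiset (Formula L)

/-- The sequent with the single proposition `A`, on the left. -/
def left (A : Formula L) : Seq L := ({A}, 0)

/-- The sequent with the single proposition `A`, on the right. -/
def right (A : Formula L) : Seq L := (0, {A})

/-- Cut-free provability. -/
def CutFree (R : RewriteSystem L) (m : Seq L) : Prop := Provable R false m.1 m.2

theorem left_add (A : Formula L) (m : Seq L) : left A + m = (A ::ₘ m.1, m.2) :=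
  Prod.ext (Multiset.singleton_add A m.1) (zero_add m.2)

theorem right_add (A : Formula L) (m : Seq L) : right A + m = (m.1, A ::ₘ m.2) :=
  Prod.ext (zero_add m.1) (Multiset.singleton_add A m.2)

namespace CutFree

variable {m n : Seq L}

theorem mono (h : CutFree R m) (n : Seq L) : CutFree R (m + n) := h.weaken n.1 n.2

theorem mono_left (h : CutFree R n) (m : Seq L) : CutFree R (m + n) := add_comm n m ▸ h.mono m

theorem contract (h : CutFree R (m + m + n)) : CutFree R (m + n) := Provable.contract h

/-- Orthogonality adds contexts while the rules share them; this contraction reconciles the two in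
the soundness proof. -/
theorem contract_self (h : CutFree R (m + m)) : CutFree R m := by
  rw [← add_zero m]
  exact contract (by rwa [add_zero])

theorem left_cons {A : Formula L} :
    CutFree R (left A + m) ↔ Provable R false (A ::ₘ m.1) m.2 := by
  rw [left_add, CutFree]

theorem right_cons {A : Formula L} :
    CutFree R (right A + m) ↔ Provable R false m.1 (A ::ₘ m.2) := by
  rw [right_add, CutFree]

end CutFree

/-! ## Forcing -/

/-- The forcing relation of the phase model of cut-free provability, whose worlds are sequents. -/
def Forces (R : RewriteSystem L) : Formula L → (ℕ → L.Term ℕ) → Seq L → Prop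
  | .atom P ts, σ, m => ∀ us, (∀ i, Relation.Join (TermRed R) ((ts i).subst σ) (us i)) →
      CutFree R (m + right (.atom P us))
  | .bot, _, m => CutFree R m
  | .imp A B, σ, m => ∀ a, Forces R A σ a → Forces R B σ (m + a)
  | .and A B, σ, m => Forces R A σ m ∧ Forces R B σ m
  | .or A B, σ, m => ∀ n, (∀ a, Forces R A σ a → CutFree R (a + n)) →
      (∀ b, Forces R B σ b → CutFree R (b + n)) → CutFree R (m + n)
  | .all A, σ, m => ∀ t, Forces R A (scons t σ) m
  | .ex A, σ, m => ∀ n, (∀ t a, Forces R A (scons t σ) a → CutFree R (a + n)) →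
      CutFree R (m + n)

/-- The sequent `n` refutes `A`. -/
def Refutes (R : RewriteSystem L) (A : Formula L) (σ : ℕ → L.Term ℕ) (n : Seq L) : Prop :=
  ∀ a, Forces R A σ a → CutFree R (a + n)

theorem Refutes.mono {A : Formula L} {σ : ℕ → L.Term ℕ} {n : Seq L} (h : Refutes R A σ n)
    (k : Seq L) : Refutes R A σ (n + k) := fun a ha => by
  rw [← add_assoc]
  exact (h a ha).mono k

theorem Refutes.mono_left {A : Formula L} {σ : ℕ → L.Term ℕ} {n : Seq L} (h : Refutes R A σ n)
    (k : Seq L) : Refutes R A σ (k + n) := add_comm n k ▸ h.mono k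

namespace Forces

variable {A : Formula L} {σ : ℕ → L.Term ℕ} {m : Seq L}

/-- Biorthogonal closure. The clauses for atoms, `⊥`, `∨` and `∃` are themselves orthogonals; the
others inherit closure from the components. This is what makes the model classical. -/
theorem of_refutes (h : ∀ n, Refutes R A σ n → CutFree R (m + n)) : Forces R A σ m := by
  induction A generalizing σ m with
  | atom P ts => exact fun us hus => h _ fun a ha => ha us hus
  | bot =>
    have := h 0 fun a ha => by rwa [add_zero]
    rwa [add_zero] at this
  | imp A B _ ihB =>
    refine fun a ha => ihB fun n hn => ?_
    rw [add_assoc]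
    -- If `a` forces `A` and `n` refutes `B`, then `a + n` refutes `A ⇒ B`.
    refine h _ fun c hc => ?_
    rw [← add_assoc]
    exact hn _ (hc a ha)
  | and A B ihA ihB =>
    exact ⟨ihA fun n hn => h n fun a ha => hn a ha.1, ihB fun n hn => h n fun a ha => hn a ha.2⟩
  | or A B _ _ => exact fun n hA hB => h n fun c hc => hc n hA hB
  | all A ih => exact fun t => ih fun n hn => h n fun a ha => hn a (ha t)
  | ex A _ => exact fun n hn => h n fun c hc => hc n hn

/-- Biorthogonality reduces this to weakening of cut-free proofs, with no further induction on `A`.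
-/
theorem mono (h : Forces R A σ m) (k : Seq L) : Forces R A σ (m + k) :=
  of_refutes fun n hn => by
    rw [add_right_comm]
    exact (hn m h).mono k

theorem mono_left (h : Forces R A σ m) (k : Seq L) : Forces R A σ (k + m) :=
  add_comm m k ▸ h.mono k

end Forces

/-! ### Invariance of forcing under rewriting and substitution -/

theorem Confluent.join_trans (hR : R.Confluent) {s t u : L.Term ℕ}
    (h₁ : Relation.Join (TermRed R) s t) (h₂ : Relation.Join (TermRed R) t u) :
    Relation.Join (TermRed R) s u := by
  obtain ⟨a, hsa, hta⟩ := h₁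
  obtain ⟨b, htb, hub⟩ := h₂
  obtain ⟨c, hac, hbc⟩ := hR t a b hta htb
  exact ⟨c, hsa.trans hac, hub.trans hbc⟩

theorem Forces.step_iff (hR : R.Confluent) {A B : Formula L} (h : Step R A B)
    (σ : ℕ → L.Term ℕ) (m : Seq L) : Forces R A σ m ↔ Forces R B σ m := by
  induction h generalizing σ m with
  | atom P ts i h =>
    have hr : ∀ j, TermRed R ((ts j).subst σ) ((Function.update ts i _ j).subst σ) := fun j => by
      by_cases hj : j = i
      · subst hj
        rw [Function.update_self]
        exact .single (h.subst σ)
      · rw [Function.update_of_ne hj]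
        exact .refl
    -- An atom and its reduct have arguments joinable to the same `us`; transitivity of joinability,
    -- hence confluence, is needed here.
    refine forall_congr' fun us => imp_congr_left (forall_congr' fun j => ⟨?_, ?_⟩)
    · exact Confluent.join_trans hR ⟨_, .refl, hr j⟩
    · exact Confluent.join_trans hR ⟨_, hr j, .refl⟩
  | imp_left B _ ih => simp only [Forces, ih]
  | imp_right A _ ih => simp only [Forces, ih]
  | and_left B _ ih => simp only [Forces, ih]
  | and_right A _ ih => simp only [Forces, ih]
  | or_left B _ ih => simp only [Forces, ih]
  | or_right A _ ih => simp only [Forces, ih]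
  | all _ ih => simp only [Forces, ih]
  | ex _ ih => simp only [Forces, ih]

theorem Forces.red_iff (hR : R.Confluent) {A B : Formula L} (h : Red R A B)
    (σ : ℕ → L.Term ℕ) (m : Seq L) : Forces R A σ m ↔ Forces R B σ m := by
  induction h with
  | refl => rfl
  | tail _ h ih => exact ih.trans (Forces.step_iff hR h σ m)

theorem Refutes.red_iff (hR : R.Confluent) {A B : Formula L} (h : Red R A B)
    (σ : ℕ → L.Term ℕ) (m : Seq L) : Refutes R A σ m ↔ Refutes R B σ m := by
  simp only [Refutes, Forces.red_iff hR h]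

theorem forces_subst (A : Formula L) (σ τ : ℕ → L.Term ℕ) (m : Seq L) :
    Forces R (A.subst σ) τ m ↔ Forces R A (fun k => (σ k).subst τ) m := by
  induction A generalizing σ τ m with
  | atom P ts => simp only [Formula.subst, Forces, term_subst_subst]
  | bot => rfl
  | imp A B ihA ihB => simp only [Formula.subst, Forces, ihA, ihB]
  | and A B ihA ihB => simp only [Formula.subst, Forces, ihA, ihB]
  | or A B ihA ihB => simp only [Formula.subst, Forces, ihA, ihB]
  | all A ih => simp only [Formula.subst, Forces, ih, up_subst_scons]
  | ex A ih => simp only [Formula.subst, Forces, ih, up_subst_scons]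

theorem forces_shift (A : Formula L) (t : L.Term ℕ) (σ : ℕ → L.Term ℕ) (m : Seq L) :
    Forces R A.shift (scons t σ) m ↔ Forces R A σ m :=
  forces_subst A _ _ m

theorem refutes_shift (A : Formula L) (t : L.Term ℕ) (σ : ℕ → L.Term ℕ) (m : Seq L) :
    Refutes R A.shift (scons t σ) m ↔ Refutes R A σ m := by
  simp only [Refutes, forces_shift]

theorem forces_inst (A : Formula L) (t : L.Term ℕ) (σ : ℕ → L.Term ℕ) (m : Seq L) :
    Forces R (A.inst t) σ m ↔ Forces R A (scons (t.subst σ) σ) m := by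
  rw [Formula.inst_eq_subst, forces_subst]
  have : (fun k => (scons t Term.var k).subst σ) = scons (t.subst σ) σ := by
    funext k
    cases k <;> rfl
  rw [this]

/-- Soundness of the calculus with the cut rule for the forcing relation. -/
theorem Provable.sound (hR : R.Confluent) {c : Bool} {Γ Δ : Multiset (Formula L)}
    (p : Provable R c Γ Δ) (σ : ℕ → L.Term ℕ) (m : Seq L) (hΓ : ∀ A ∈ Γ, Forces R A σ m)
    (hΔ : ∀ A ∈ Δ, Refutes R A σ m) : CutFree R m := by
  have weaken : ∀ {Γ Δ : Multiset (Formula L)} {σ : ℕ → L.Term ℕ} {m : Seq L},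
      (∀ A ∈ Γ, Forces R A σ m) → (∀ A ∈ Δ, Refutes R A σ m) → ∀ k : Seq L,
      (∀ A ∈ Γ, Forces R A σ (m + k)) ∧ (∀ A ∈ Δ, Refutes R A σ (m + k)) :=
    fun hΓ hΔ k => ⟨fun A hA => (hΓ A hA).mono k, fun A hA => (hΔ A hA).mono k⟩
  induction p generalizing σ m with
  | ax h₁ h₂ =>
    have h := (Forces.red_iff hR h₁ σ m).1 (hΓ _ (Multiset.mem_cons_self _ _))
    exact CutFree.contract_self
      ((Refutes.red_iff hR h₂ σ m).1 (hΔ _ (Multiset.mem_cons_self _ _)) m h)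
  | cut_rule _ h₁ h₂ _ _ ih₁ ih₂ =>
    simp only [Multiset.forall_mem_cons, ← Forces.red_iff hR h₂, ← Refutes.red_iff hR h₁]
      at ih₁ ih₂
    -- Cut becomes composition: if `a` forces `C`, so does `m + a`, and the second premise at this
    -- world shows that `m` refutes `C`.
    refine ih₁ σ m hΓ ⟨fun a ha => ?_, hΔ⟩
    obtain ⟨hΓ', hΔ'⟩ := weaken hΓ hΔ a
    rw [add_comm]
    exact ih₂ σ _ ⟨ha.mono_left m, hΓ'⟩ hΔ'
  | contr_left h₁ h₂ _ ih =>
    simp only [Multiset.forall_mem_cons, ← Forces.red_iff hR h₁, ← Forces.red_iff hR h₂]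
      at ih hΓ
    exact ih σ m ⟨hΓ.1, hΓ.1, hΓ.2⟩ hΔ
  | contr_right h₁ h₂ _ ih =>
    simp only [Multiset.forall_mem_cons, ← Refutes.red_iff hR h₁, ← Refutes.red_iff hR h₂]
      at ih hΔ
    exact ih σ m hΓ ⟨hΔ.1, hΔ.1, hΔ.2⟩
  | weak_left _ ih => exact ih σ m (fun A hA => hΓ A (Multiset.mem_cons_of_mem hA)) hΔ
  | weak_right _ ih => exact ih σ m hΓ (fun A hA => hΔ A (Multiset.mem_cons_of_mem hA))
  | imp_left h _ _ ih₁ ih₂ =>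
    simp only [Multiset.forall_mem_cons, Forces.red_iff hR h] at ih₁ ih₂ hΓ
    refine ih₁ σ m hΓ.2 ⟨fun a ha => ?_, hΔ⟩
    obtain ⟨hΓ', hΔ'⟩ := weaken hΓ.2 hΔ a
    rw [add_comm]
    exact ih₂ σ _ ⟨hΓ.1 a ha, hΓ'⟩ hΔ'
  | imp_right h _ ih =>
    simp only [Multiset.forall_mem_cons, Refutes.red_iff hR h] at ih hΔ
    -- As `m` refutes the implication, it suffices that `m` also forces it: their sum `m + m` then
    -- contracts to `m`. The other right rules for `∧`, `∨`, `∀` follow this pattern.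
    refine CutFree.contract_self (hΔ.1 m fun a ha => Forces.of_refutes fun n hn => ?_)
    obtain ⟨hΓ', hΔ'⟩ := weaken hΓ hΔ.2 (a + n)
    rw [add_assoc]
    exact ih σ _ ⟨(ha.mono n).mono_left m, hΓ'⟩ ⟨(hn.mono_left a).mono_left m, hΔ'⟩
  | and_left h _ ih =>
    simp only [Multiset.forall_mem_cons, Forces.red_iff hR h] at ih hΓ
    exact ih σ m ⟨hΓ.1.1, hΓ.1.2, hΓ.2⟩ hΔ
  | and_right h _ _ ih₁ ih₂ =>
    simp only [Multiset.forall_mem_cons, Refutes.red_iff hR h] at ih₁ ih₂ hΔ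
    refine CutFree.contract_self (hΔ.1 m ⟨Forces.of_refutes fun n hn => ?_,
      Forces.of_refutes fun n hn => ?_⟩)
    · obtain ⟨hΓ', hΔ'⟩ := weaken hΓ hΔ.2 n
      exact ih₁ σ _ hΓ' ⟨hn.mono_left m, hΔ'⟩
    · obtain ⟨hΓ', hΔ'⟩ := weaken hΓ hΔ.2 n
      exact ih₂ σ _ hΓ' ⟨hn.mono_left m, hΔ'⟩
  | or_left h _ _ ih₁ ih₂ =>
    simp only [Multiset.forall_mem_cons, Forces.red_iff hR h] at ih₁ ih₂ hΓ
    refine CutFree.contract_self (hΓ.1 m (fun a ha => ?_) fun a ha => ?_)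
    · obtain ⟨hΓ', hΔ'⟩ := weaken hΓ.2 hΔ a
      rw [add_comm]
      exact ih₁ σ _ ⟨ha.mono_left m, hΓ'⟩ hΔ'
    · obtain ⟨hΓ', hΔ'⟩ := weaken hΓ.2 hΔ a
      rw [add_comm]
      exact ih₂ σ _ ⟨ha.mono_left m, hΓ'⟩ hΔ'
  | or_right h _ ih =>
    simp only [Multiset.forall_mem_cons, Refutes.red_iff hR h] at ih hΔ
    refine CutFree.contract_self (hΔ.1 m fun n hA hB => ?_)
    obtain ⟨hΓ', hΔ'⟩ := weaken hΓ hΔ.2 n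
    exact ih σ _ hΓ' ⟨Refutes.mono_left hA m, Refutes.mono_left hB m, hΔ'⟩
  | bot_left h =>
    simp only [Multiset.forall_mem_cons, Forces.red_iff hR h] at hΓ
    exact hΓ.1
  | all_left t h _ ih =>
    simp only [Multiset.forall_mem_cons, Forces.red_iff hR h, forces_inst] at ih hΓ
    exact ih σ m ⟨hΓ.1 _, hΓ.2⟩ hΔ
  | all_right h _ ih =>
    simp only [Multiset.forall_mem_cons, Refutes.red_iff hR h] at ih hΔ
    refine CutFree.contract_self (hΔ.1 m fun t => Forces.of_refutes fun n hn => ?_)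
    obtain ⟨hΓ', hΔ'⟩ := weaken hΓ hΔ.2 n
    -- The eigenvariable is interpreted by an arbitrary `t`, which the shifted side propositions do
    -- not see.
    refine ih (scons t σ) _ ?_ ⟨hn.mono_left m, ?_⟩
    · simpa only [Multiset.forall_mem_map_iff, forces_shift] using hΓ'
    · simpa only [Multiset.forall_mem_map_iff, refutes_shift] using hΔ'
  | ex_left h _ ih =>
    simp only [Multiset.forall_mem_cons, Forces.red_iff hR h] at ih hΓ
    refine CutFree.contract_self (hΓ.1 m fun t a ha => ?_)
    obtain ⟨hΓ', hΔ'⟩ := weaken hΓ.2 hΔ a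
    rw [add_comm]
    refine ih (scons t σ) _ ⟨ha.mono_left m, ?_⟩ ?_
    · simpa only [Multiset.forall_mem_map_iff, forces_shift] using hΓ'
    · simpa only [Multiset.forall_mem_map_iff, refutes_shift] using hΔ'
  | ex_right t h _ ih =>
    simp only [Multiset.forall_mem_cons, Refutes.red_iff hR h] at ih hΔ
    refine ih σ m hΓ ⟨fun a ha => ?_, hΔ.2⟩
    exact hΔ.1 a fun n hn => hn _ a ((forces_inst _ _ _ _).1 ha)

/-! ## Completeness -/

/-- Only the instance at a fresh variable matters; renaming that variable turns its proof into a
premise of the quantifier rule. -/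
theorem CutFree.all_right {A : Formula L} {m : Seq L}
    (h : ∀ N, CutFree R (right (A.inst (Term.var N)) + m)) : CutFree R (right (.all A) + m) := by
  obtain ⟨N, σ, hΓ, hΔ, hA⟩ := exists_fresh m.1 m.2 A
  have p := (CutFree.right_cons.1 (h N)).subst σ
  rw [Multiset.map_cons, hΓ, hΔ, hA] at p
  exact CutFree.right_cons.2 (.all_right (Red.refl _) p)

theorem CutFree.ex_left {A : Formula L} {m : Seq L}
    (h : ∀ N, CutFree R (left (A.inst (Term.var N)) + m)) : CutFree R (left (.ex A) + m) := by
  obtain ⟨N, σ, hΓ, hΔ, hA⟩ := exists_fresh m.1 m.2 A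
  have p := (CutFree.left_cons.1 (h N)).subst σ
  rw [Multiset.map_cons, hΓ, hΔ, hA] at p
  exact CutFree.left_cons.2 (.ex_left (Red.refl _) p)

/-- The left rule of each connective gives the first half and the right rule the second. Both are
proved together because implication exchanges them on its antecedent. -/
theorem forces_left_and_refutes_right (A : Formula L) (σ : ℕ → L.Term ℕ) :
    Forces R A σ (left (A.subst σ)) ∧ Refutes R A σ (right (A.subst σ)) := by
  induction A generalizing σ with
  | atom P ts =>
    refine ⟨fun us hus => ?_, fun a ha => ha _ fun i => ⟨_, .refl, .refl⟩⟩
    choose vs h₁ h₂ using hus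
    -- Joinability of the arguments is exactly the side condition of the axiom.
    exact CutFree.left_cons.2 (.ax (Δ := 0) (Red.atom P h₁) (Red.atom P h₂))
  | bot =>
    refine ⟨?_, fun a ha => ha.mono _⟩
    exact Provable.bot_left (Γ := 0) (Red.refl _)
  | imp A B ihA ihB =>
    refine ⟨fun a ha => Forces.of_refutes fun n hn => ?_, fun c hc => ?_⟩
    · rw [add_assoc]
      refine CutFree.left_cons.2 (.imp_left (Red.refl _) (CutFree.right_cons.1 ?_)
        (CutFree.left_cons.1 ?_))
      · rw [← add_assoc, add_comm (right _)]
        exact ((ihA σ).2 a ha).mono n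
      · rw [add_left_comm]
        exact (hn _ (ihB σ).1).mono_left a
    · rw [add_comm]
      refine CutFree.right_cons.2 (.imp_right (Red.refl _) ?_)
      have := (ihB σ).2 _ (hc _ (ihA σ).1)
      rw [add_comm, CutFree.right_cons, add_comm, left_add] at this
      exact this
  | and A B ihA ihB =>
    refine ⟨⟨Forces.of_refutes fun n hn => ?_, Forces.of_refutes fun n hn => ?_⟩, fun c hc => ?_⟩
    · refine CutFree.left_cons.2 (.and_left (Red.refl _) ?_)
      rw [Multiset.cons_swap]
      exact .weak_left (CutFree.left_cons.1 (hn _ (ihA σ).1))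
    · exact CutFree.left_cons.2 (.and_left (Red.refl _)
        (.weak_left (CutFree.left_cons.1 (hn _ (ihB σ).1))))
    · rw [add_comm]
      refine CutFree.right_cons.2 (.and_right (Red.refl _) (CutFree.right_cons.1 ?_)
        (CutFree.right_cons.1 ?_))
      · rw [add_comm]
        exact (ihA σ).2 c hc.1
      · rw [add_comm]
        exact (ihB σ).2 c hc.2
  | or A B ihA ihB =>
    refine ⟨fun n hA hB => ?_, fun c hc => ?_⟩
    · exact CutFree.left_cons.2 (.or_left (Red.refl _)
        (CutFree.left_cons.1 (hA _ (ihA σ).1)) (CutFree.left_cons.1 (hB _ (ihB σ).1)))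
    · have := hc _ ((ihA σ).2.mono (right (B.subst σ))) ((ihB σ).2.mono_left (right (A.subst σ)))
      rw [add_comm, add_assoc, CutFree.right_cons, right_add] at this
      rw [add_comm]
      exact CutFree.right_cons.2 (.or_right (Red.refl _) this)
  | all A ih =>
    refine ⟨fun t => Forces.of_refutes fun n hn => ?_, fun c hc => ?_⟩
    · refine CutFree.left_cons.2 (.all_left t (Red.refl _) (CutFree.left_cons.1 ?_))
      rw [Formula.subst_up_inst]
      exact hn _ (ih _).1
    · rw [add_comm]
      refine CutFree.all_right fun N => ?_
      rw [Formula.subst_up_inst, add_comm]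
      exact (ih _).2 c (hc _)
  | ex A ih =>
    refine ⟨fun n hn => ?_, fun c hc => hc _ fun t a ha => ?_⟩
    · refine CutFree.ex_left fun N => ?_
      rw [Formula.subst_up_inst]
      exact hn _ _ (ih _).1
    · rw [add_comm]
      refine CutFree.right_cons.2 (.ex_right t (Red.refl _) (CutFree.right_cons.1 ?_))
      rw [Formula.subst_up_inst, add_comm]
      exact (ih _).2 a ha

theorem RewriteSystem.Confluent.cutRedundant (hR : R.Confluent) : CutRedundant R := by
  intro Γ Δ p
  -- The world is the sequent itself, under the identity substitution; monotonicity extends Okada's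
  -- lemma from one proposition to all of it.
  refine p.sound hR Term.var (Γ, Δ) (fun A hA => ?_) fun A hA => ?_
  · obtain ⟨Γ', rfl⟩ := Multiset.exists_cons_of_mem hA
    have := (forces_left_and_refutes_right (R := R) A Term.var).1.mono (Γ', Δ)
    rwa [A.subst_var, left_add] at this
  · obtain ⟨Δ', rfl⟩ := Multiset.exists_cons_of_mem hA
    have := (forces_left_and_refutes_right (R := R) A Term.var).2.mono (Γ, Δ')
    rwa [A.subst_var, right_add] at this

end AsymmetricModulo

theorem mainTheorem2 {L : FirstOrder.Language.{u, v}}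
    (hL : ∃ n : ℕ, Nonempty (L.Relations (n + 1)))
    (R : AsymmetricModulo.RewriteSystem L) :
    AsymmetricModulo.CutRedundant R ↔ R.Confluent := by
  obtain ⟨n, ⟨P⟩⟩ := hL
  exact ⟨fun h => h.confluent P, fun h => h.cutRedundant⟩
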